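/- Let $\mathbb C_+$ be the open upper half-plane, let $\mathscr S_n(\mathbb C_+)$ be the set of analytic functions $B:\mathbb C_+\to\mathbb C^{n\times n}$ with $\|B(w)\|\le 1$ (operator norm) for all $w$, and let $\mathscr U_n$ be the set of unitary $n\times n$ matrices. For $F\in\mathscr S_n(\mathbb C_+)$ with $I-F(w)$ invertible for all $w\in\mathbb C_+$, the Clark measure $\mu^F$ is the unique nonnegative $n\times n$ matrix-valued Borel measure on $\mathbb R$, finite on bounded sets and with $\int \frac{\mu^F(dt)}{1+t^2}$ convergent, such that for some constant positive semidefinite matrix $c$ $$\operatorname{Re}\big[(I-F(w))^{-1}(I+F(w))\big]=c\,\operatorname{Im}w+\int_{-\infty}^{\infty}\operatorname{Re}\Big(\frac1{i\pi}\,\frac1{t-w}\Big)\,\mu^F(dt)\qquad(w\in\mathbb C_+),$$ where $\operatorname{Re}M=\tfrac12(M+M^*)$ for a matrix $M$. **Theorem.** Let $B_1,B_2\in\mathscr S_n(\mathbb C_+)$ and $R,Q\in\mathscr U_n$ be such that $B_1(w)=R\,B_2(w)\,Q$ for all $w\in\mathbb C_+$. Let $\alpha\in\mathscr U_n$ be such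 that $I-B_1(w)\alpha^*$ is invertible for all $w\in\mathbb C_+$. Then the Clark measures $\mu^{B_1\alpha^*}$ and $\mu^{B_2(Q\alpha^*R)}$ exist and are unique, and for all $s\in\mathbb R$ $$\mu^{B_1\alpha^*}(\{s\})=R\,\mu^{B_2(Q\alpha^*R)}(\{s\})\,R^*.$$ -/

import Mathlib

open scoped Matrix ComplexOrder

noncomputable section

/-- The Schur class `S_n(X)`: the closed unit ball of the bounded analytic `n × n` matrix-valued
functions on `X`, that is, the analytic functions whose values are contractions of `ℂⁿ` with its
Euclidean norm. Only the values on `X` matter. -/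
structure IsSchur {n : ℕ} (X : Set ℂ) (B : ℂ → Matrix (Fin n) (Fin n) ℂ) : Prop where
  analytic : ∀ i j, DifferentiableOn ℂ (fun w => B w i j) X
  contractive : ∀ w ∈ X, ‖Matrix.toEuclideanCLM (𝕜 := ℂ) (B w)‖ ≤ 1

/-- The open upper half-plane `ℂ₊`. -/
def upperHalf : Set ℂ := {w | 0 < w.im}

/-- The quadratic form `Re ⟨M x, x⟩` of a matrix `M`; it equals `⟨M x, x⟩` when `M` is Hermitian,
and `⟨(Re M) x, x⟩` with `Re M = (M + M*) / 2` in general. -/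
def qform {n : ℕ} (M : Matrix (Fin n) (Fin n) ℂ) (x : Fin n → ℂ) : ℝ :=
  (star x ⬝ᵥ (M *ᵥ x)).re

/-- A nonnegative `n × n` matrix-valued Borel measure on the real line, finite on bounded sets
(in general it is not finite on `ℝ`): a countably additive function on the bounded Borel sets with
positive semidefinite values. It is given the value `0` on all other sets, so that two such
measures are equal as soon as they agree on the bounded Borel sets. -/
structure MatrixMeasure (n : ℕ) where
  toFun : Set ℝ → Matrix (Fin n) (Fin n) ℂ
  posSemidef' : ∀ Ω, MeasurableSet Ω → Bornology.IsBounded Ω → (toFun Ω).PosSemidef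
  hasSum' : ∀ f : ℕ → Set ℝ, (∀ k, MeasurableSet (f k)) → Pairwise (Function.onFun Disjoint f) →
    Bornology.IsBounded (⋃ k, f k) → HasSum (fun k => toFun (f k)) (toFun (⋃ k, f k))
  eq_zero' : ∀ Ω, ¬ (MeasurableSet Ω ∧ Bornology.IsBounded Ω) → toFun Ω = 0

namespace MatrixMeasure

variable {n : ℕ}

instance : CoeFun (MatrixMeasure n) (fun _ => Set ℝ → Matrix (Fin n) (Fin n) ℂ) := ⟨toFun⟩

instance : Zero (MatrixMeasure n) :=
  ⟨{ toFun := fun _ => 0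
     posSemidef' := fun _ _ _ => Matrix.PosSemidef.zero
     hasSum' := fun _ _ _ _ => hasSum_zero
     eq_zero' := fun _ _ => rfl }⟩

theorem qform_hasSum {f : ℕ → Matrix (Fin n) (Fin n) ℂ} {M : Matrix (Fin n) (Fin n) ℂ}
    (h : HasSum f M) (x : Fin n → ℂ) : HasSum (fun k => qform (f k) x) (qform M x) := by
  let q : Matrix (Fin n) (Fin n) ℂ →+ ℝ :=
    { toFun := fun A => qform A x
      map_zero' := by simp [qform]
      map_add' := fun A B => by simp [qform, Matrix.add_mulVec, dotProduct_add] }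
  have hq : Continuous q := by
    change Continuous fun A : Matrix (Fin n) (Fin n) ℂ => (star x ⬝ᵥ (A *ᵥ x)).re
    fun_prop
  exact h.map q hq

/-- The bounded shells `{t : k ≤ |t| < k + 1}`, which partition `ℝ`. -/
def shell (k : ℕ) : Set ℝ := {t | ⌊|t|⌋₊ = k}

theorem measurableSet_shell (k : ℕ) : MeasurableSet (shell k) :=
  (Nat.measurable_floor.comp measurable_norm) (measurableSet_singleton k)

theorem isBounded_shell (k : ℕ) : Bornology.IsBounded (shell k) := by
  refine (Metric.isBounded_closedBall (x := (0 : ℝ)) (r := k + 1)).subset fun t ht => ?_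
  have h := Nat.lt_floor_add_one |t|
  have ht' : ⌊|t|⌋₊ = k := ht
  rw [ht'] at h
  simpa using h.le

theorem disjoint_shell : Pairwise (Function.onFun Disjoint shell) := by
  intro i j hij
  refine Set.disjoint_left.2 fun t hi hj => hij ?_
  exact (show ⌊|t|⌋₊ = i from hi).symm.trans hj

theorem iUnion_inter_shell (Ω : Set ℝ) : ⋃ k, Ω ∩ shell k = Ω := by
  ext t
  simp [shell]

theorem empty (μ : MatrixMeasure n) : μ ∅ = 0 := by
  have h := μ.hasSum' (fun _ => ∅) (fun _ => MeasurableSet.empty)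
    (fun _ _ _ => disjoint_bot_left) (by simp)
  simpa using h.summable.tendsto_atTop_zero

theorem qform_nonneg (μ : MatrixMeasure n) (x : Fin n → ℂ) {Ω : Set ℝ} (hm : MeasurableSet Ω)
    (hb : Bornology.IsBounded Ω) : 0 ≤ qform (μ Ω) x :=
  (μ.posSemidef' Ω hm hb).re_dotProduct_nonneg x

/-- The restriction of the scalar measure `⟨μ(·) x, x⟩` to a bounded shell. -/
def scalarShell (μ : MatrixMeasure n) (x : Fin n → ℂ) (k : ℕ) : MeasureTheory.Measure ℝ :=
  MeasureTheory.Measure.ofMeasurable (fun Ω _ => ENNReal.ofReal (qform (μ (Ω ∩ shell k)) x))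
    (by simp [μ.empty, qform])
    (by
      intro f hf hd
      have hm : ∀ i, MeasurableSet (f i ∩ shell k) := fun i => (hf i).inter (measurableSet_shell k)
      have hb : ∀ Ω : Set ℝ, Bornology.IsBounded (Ω ∩ shell k) := fun Ω =>
        (isBounded_shell k).subset Set.inter_subset_right
      have h := qform_hasSum (μ.hasSum' (fun i => f i ∩ shell k) hm
        (fun i j hij => (hd hij).mono Set.inter_subset_left Set.inter_subset_left)
        (by rw [← Set.iUnion_inter]; exact hb _)) x
      rw [← Set.iUnion_inter] at h
      rw [← h.tsum_eq]
      exact ENNReal.ofReal_tsum_of_nonneg (fun i => μ.qform_nonneg x (hm i) (hb _)) h.summable)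

/-- The scalar nonnegative Borel measure `Ω ↦ ⟨μ(Ω) x, x⟩` on `ℝ`. -/
def scalar (μ : MatrixMeasure n) (x : Fin n → ℂ) : MeasureTheory.Measure ℝ :=
  MeasureTheory.Measure.sum (μ.scalarShell x)

theorem scalar_apply (μ : MatrixMeasure n) (x : Fin n → ℂ) {Ω : Set ℝ} (hm : MeasurableSet Ω)
    (hb : Bornology.IsBounded Ω) : μ.scalar x Ω = ENNReal.ofReal (qform (μ Ω) x) := by
  have hm' : ∀ k, MeasurableSet (Ω ∩ shell k) := fun k => hm.inter (measurableSet_shell k)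
  have hb' : ∀ k, Bornology.IsBounded (Ω ∩ shell k) := fun k => hb.subset Set.inter_subset_left
  have h := qform_hasSum (μ.hasSum' (fun k => Ω ∩ shell k) hm'
    (fun i j hij => (disjoint_shell hij).mono Set.inter_subset_right Set.inter_subset_right)
    (by rw [iUnion_inter_shell]; exact hb)) x
  rw [iUnion_inter_shell] at h
  rw [scalar, MeasureTheory.Measure.sum_apply _ hm, ← h.tsum_eq,
    ENNReal.ofReal_tsum_of_nonneg (fun k => μ.qform_nonneg x (hm' k) (hb' k)) h.summable]
  exact tsum_congr fun k => MeasureTheory.Measure.ofMeasurable_apply Ω hm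

end MatrixMeasure

/-- The Nevanlinna function `H = (I - F)⁻¹ (I + F)` of a matrix-valued function `F`. -/
def nevanlinna {n : ℕ} (F : ℂ → Matrix (Fin n) (Fin n) ℂ) (w : ℂ) : Matrix (Fin n) (Fin n) ℂ :=
  (1 - F w)⁻¹ * (1 + F w)

/-- `μ` represents `F` in the Nevanlinna representation
`Re H(w) = c Im w + ∫ Re ((1 / (iπ)) (1 / (t - w))) μ(dt)` on `ℂ₊`, with a constant positive
semidefinite matrix `c` and `∫ μ(dt) / (1 + t²)` convergent. The identity of Hermitian matrices is
written as the equality of their quadratic forms. -/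
def IsClarkMeasure {n : ℕ} (F : ℂ → Matrix (Fin n) (Fin n) ℂ) (μ : MatrixMeasure n) : Prop :=
  ∃ c : Matrix (Fin n) (Fin n) ℂ, c.PosSemidef ∧ ∀ x : Fin n → ℂ,
    MeasureTheory.Integrable (fun t : ℝ => (1 + t ^ 2)⁻¹) (μ.scalar x) ∧
    ∀ w ∈ upperHalf, qform (nevanlinna F w) x =
      qform c x * w.im +
        ∫ t : ℝ, ((1 / (Complex.I * Real.pi)) * (1 / ((t : ℂ) - w))).re ∂(μ.scalar x)

open Classical in
/-- The Clark measure `μ^F`: the matrix-valued measure that represents `F`. -/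
def clarkMeasure {n : ℕ} (F : ℂ → Matrix (Fin n) (Fin n) ℂ) : MatrixMeasure n :=
  if h : ∃ μ, IsClarkMeasure F μ then h.choose else 0

end

/-!
Composing with the Cayley transform turns `qform (nevanlinna F ·) x` into a nonnegative harmonic
function on the disk, which by Herglotz's theorem is the Poisson integral of a measure on the
circle; back on the half-plane this is the Nevanlinna representation, the mass at `1` becoming the
term linear in `Im w`. Stieltjes inversion recovers the measure from the function it represents, so
the scalar measures obtained for the various `x` inherit the polarization identity from the
quadratic form and come from a single matrix-valued measure.

Conjugating `F` by a unitary `R` conjugates the Nevanlinna function, hence any measure representing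
it. As `B₂ (Q αᴴ R) = Rᴴ (B₁ αᴴ) R`, uniqueness of the Clark measures gives the theorem.
-/

noncomputable section

open MeasureTheory Filter Topology ProbabilityTheory

/-- The Poisson kernel of the upper half-plane at the point `w`, as a function of the boundary
point `t`, normalized to have integral `1`. -/
def halfPlanePoisson (w : ℂ) (t : ℝ) : ℝ :=
  ((1 / (Complex.I * Real.pi)) * (1 / ((t : ℂ) - w))).re

theorem halfPlanePoisson_eq (w : ℂ) (t : ℝ) :
    halfPlanePoisson w t = Real.pi⁻¹ * (w.im / ((t - w.re) ^ 2 + w.im ^ 2)) := by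
  have h : (1 / (Complex.I * Real.pi)) * (1 / ((t : ℂ) - w)) =
      ((Real.pi⁻¹ : ℝ) : ℂ) * (-Complex.I * ((t : ℂ) - w)⁻¹) := by
    rw [one_div, one_div, mul_inv, Complex.inv_I, Complex.ofReal_inv]
    ring
  rw [halfPlanePoisson, h, Complex.re_ofReal_mul]
  congr 1
  simp only [neg_mul, Complex.neg_re, Complex.I_mul_re, Complex.inv_im, Complex.normSq_apply,
    Complex.sub_re, Complex.sub_im, Complex.ofReal_re, Complex.ofReal_im]
  ring

theorem halfPlanePoisson_nonneg {w : ℂ} (hw : 0 ≤ w.im) (t : ℝ) : 0 ≤ halfPlanePoisson w t := by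
  rw [halfPlanePoisson_eq]
  positivity

theorem halfPlanePoisson_le {w : ℂ} (hw : 0 < w.im) (t : ℝ) :
    halfPlanePoisson w t ≤ Real.pi⁻¹ * w.im⁻¹ := by
  rw [halfPlanePoisson_eq]
  refine mul_le_mul_of_nonneg_left ?_ (by positivity)
  rw [div_le_iff₀ (by positivity), inv_mul_eq_div, le_div_iff₀ hw]
  nlinarith [sq_nonneg (t - w.re)]

theorem sq_mul_halfPlanePoisson_le {w : ℂ} (hw : 0 < w.im) (t : ℝ) :
    (t - w.re) ^ 2 * halfPlanePoisson w t ≤ Real.pi⁻¹ * w.im := by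
  rw [halfPlanePoisson_eq, mul_left_comm]
  refine mul_le_mul_of_nonneg_left ?_ (by positivity)
  rw [mul_div_assoc', div_le_iff₀ (by positivity)]
  nlinarith [pow_pos hw 3]

theorem one_add_sq_mul_halfPlanePoisson_le {K : ℝ} {w : ℂ} (hw : 0 < w.im) (hK : |w.re| ≤ K)
    (t : ℝ) : (1 + t ^ 2) * halfPlanePoisson w t ≤
      (1 + 2 * K ^ 2) * halfPlanePoisson w t + 2 * (Real.pi⁻¹ * w.im) := by
  have hre : w.re ^ 2 ≤ K ^ 2 := sq_le_sq' (neg_le_of_abs_le hK) (le_of_abs_le hK)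
  have hweight : 1 + t ^ 2 ≤ 1 + 2 * K ^ 2 + 2 * (t - w.re) ^ 2 := by
    nlinarith [sq_nonneg (t - 2 * w.re)]
  calc (1 + t ^ 2) * halfPlanePoisson w t
      ≤ (1 + 2 * K ^ 2 + 2 * (t - w.re) ^ 2) * halfPlanePoisson w t :=
        mul_le_mul_of_nonneg_right hweight (halfPlanePoisson_nonneg hw.le t)
    _ = (1 + 2 * K ^ 2) * halfPlanePoisson w t
          + 2 * ((t - w.re) ^ 2 * halfPlanePoisson w t) := by ring
    _ ≤ _ := by gcongr _ + 2 * ?_; exact sq_mul_halfPlanePoisson_le hw t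

theorem continuous_halfPlanePoisson_mk {y : ℝ} (hy : 0 < y) :
    Continuous fun p : ℝ × ℝ => halfPlanePoisson ⟨p.1, y⟩ p.2 := by
  simp only [halfPlanePoisson_eq]
  refine continuous_const.mul (continuous_const.div (by fun_prop) fun p => ?_)
  positivity

theorem continuous_halfPlanePoisson {w : ℂ} (hw : 0 < w.im) :
    Continuous (halfPlanePoisson w) :=
  ((continuous_halfPlanePoisson_mk hw).comp (Continuous.prodMk_right w.re)).congr fun _ => rfl

theorem halfPlanePoisson_mk_eq_cauchyPDFReal (s t : ℝ) (y : NNReal) :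
    halfPlanePoisson ⟨s, y⟩ t = cauchyPDFReal t y s := by
  rw [halfPlanePoisson_eq, cauchyPDFReal_def, mul_assoc, div_eq_mul_inv, sub_sq_comm]

theorem integrable_halfPlanePoisson_mk {y : ℝ} (hy : 0 ≤ y) (t : ℝ) :
    Integrable fun s => halfPlanePoisson ⟨s, y⟩ t := by
  lift y to NNReal using hy
  simpa only [halfPlanePoisson_mk_eq_cauchyPDFReal] using integrable_cauchyPDFReal t

theorem integral_halfPlanePoisson_mk {y : ℝ} (hy : 0 < y) (t : ℝ) :
    ∫ s, halfPlanePoisson ⟨s, y⟩ t = 1 := by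
  lift y to NNReal using hy.le
  simpa only [halfPlanePoisson_mk_eq_cauchyPDFReal] using
    integral_cauchyPDFReal_eq_one t (NNReal.coe_pos.1 hy).ne'

theorem tendsto_integral_mul_halfPlanePoisson {g : ℝ → ℝ} (hg : Integrable g) {t : ℝ}
    (hgt : ContinuousAt g t) :
    Tendsto (fun y => ∫ s, g s * halfPlanePoisson ⟨s, y⟩ t) (𝓝[>] 0) (𝓝 (g t)) := by
  have hnonneg (v : ℝ) : 0 ≤ halfPlanePoisson ⟨v, 1⟩ 0 := halfPlanePoisson_nonneg zero_le_one 0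
  have hdecay : Tendsto (fun v : ℝ => ‖v‖ ^ Module.finrank ℝ ℝ * halfPlanePoisson ⟨v, 1⟩ 0)
      (Bornology.cobounded ℝ) (𝓝 0) := by
    refine squeeze_zero (fun v => mul_nonneg (by positivity) (hnonneg v)) (fun v => ?_)
      (by simpa using (tendsto_inv₀_cobounded (α := ℝ)).norm.const_mul Real.pi⁻¹)
    rcases eq_or_ne v 0 with rfl | hv
    · simp
    · have h := sq_mul_halfPlanePoisson_le (w := ⟨v, 1⟩) one_pos 0
      rw [zero_sub, neg_sq, mul_one] at h
      rw [Module.finrank_self, pow_one, Real.norm_eq_abs, ← div_eq_mul_inv,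
        le_div_iff₀ (abs_pos.2 hv), mul_right_comm, abs_mul_abs_self, ← sq]
      exact h
  have hlim := (tendsto_integral_comp_smul_smul_of_integrable' hnonneg
    (integral_halfPlanePoisson_mk one_pos 0) hdecay hg hgt).comp tendsto_inv_nhdsGT_zero
  refine hlim.congr' ?_
  filter_upwards [self_mem_nhdsWithin] with y (hy : 0 < y)
  refine integral_congr_ae (.of_forall fun s => ?_)
  simp only [Module.finrank_self, pow_one, halfPlanePoisson_eq, smul_eq_mul]
  field_simp
  ring

theorem exists_halfPlanePoisson_le (K : ℝ) {y : ℝ} (hy : 0 < y) :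
    ∃ C : ℝ, ∀ s, |s| ≤ K → ∀ t, halfPlanePoisson ⟨s, y⟩ t ≤ C * (1 + t ^ 2)⁻¹ := by
  refine ⟨(1 + 2 * K ^ 2) * (Real.pi⁻¹ * y⁻¹) + 2 * (Real.pi⁻¹ * y), fun s hs t => ?_⟩
  rw [← div_eq_mul_inv, le_div_iff₀ (by positivity), mul_comm]
  refine (one_add_sq_mul_halfPlanePoisson_le hy hs t).trans ?_
  gcongr
  exact halfPlanePoisson_le hy t

theorem exists_abs_integral_mul_halfPlanePoisson_le {g : ℝ → ℝ} (hg : Continuous g)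
    (hc : HasCompactSupport g) : ∃ C : ℝ, ∀ y ∈ Set.Ioc (0 : ℝ) 1, ∀ t,
      |∫ s, g s * halfPlanePoisson ⟨s, y⟩ t| ≤ C * (1 + t ^ 2)⁻¹ := by
  obtain ⟨M, hM⟩ := hc.exists_bound_of_continuous hg
  obtain ⟨K, hK⟩ := hc.isBounded.exists_norm_le
  refine ⟨(1 + 2 * K ^ 2) * M + 2 * Real.pi⁻¹ * ∫ s, |g s|, fun y ⟨hy, hy1⟩ t => ?_⟩
  have hbound (s : ℝ) : ‖(1 + t ^ 2) * (g s * halfPlanePoisson ⟨s, y⟩ t)‖ ≤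
      (1 + 2 * K ^ 2) * M * halfPlanePoisson ⟨s, y⟩ t + 2 * Real.pi⁻¹ * |g s| := by
    have hP := halfPlanePoisson_nonneg (w := ⟨s, y⟩) hy.le t
    rw [norm_mul, norm_mul, Real.norm_of_nonneg (by positivity), Real.norm_of_nonneg hP]
    by_cases hs : s ∈ tsupport g
    · calc (1 + t ^ 2) * (‖g s‖ * halfPlanePoisson ⟨s, y⟩ t)
          = ‖g s‖ * ((1 + t ^ 2) * halfPlanePoisson ⟨s, y⟩ t) := by ring
        _ ≤ ‖g s‖ * ((1 + 2 * K ^ 2) * halfPlanePoisson ⟨s, y⟩ t + 2 * (Real.pi⁻¹ * 1)) := by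
            gcongr
            exact (one_add_sq_mul_halfPlanePoisson_le hy (hK s hs) t).trans (by gcongr)
        _ = (1 + 2 * K ^ 2) * ‖g s‖ * halfPlanePoisson ⟨s, y⟩ t + 2 * Real.pi⁻¹ * |g s| := by
            rw [Real.norm_eq_abs]; ring
        _ ≤ _ := by gcongr; exact hM s
    · have hM0 : 0 ≤ M := (norm_nonneg _).trans (hM s)
      rw [image_eq_zero_of_notMem_tsupport hs, norm_zero, zero_mul, mul_zero]
      positivity
  have hgi : Integrable fun s => |g s| := (hg.integrable_of_hasCompactSupport hc).abs
  have hP := integrable_halfPlanePoisson_mk hy.le t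
  have hinteg := norm_integral_le_of_norm_le ((hP.const_mul _).add (hgi.const_mul _))
    (.of_forall hbound)
  simp only [Pi.add_apply] at hinteg
  rw [integral_const_mul, norm_mul, Real.norm_of_nonneg (by positivity),
    integral_add (hP.const_mul _) (hgi.const_mul _), integral_const_mul, integral_const_mul,
    integral_halfPlanePoisson_mk hy, mul_one] at hinteg
  rwa [← div_eq_mul_inv, le_div_iff₀' (by positivity)]

/-- The function `u` on the upper half-plane is the Poisson integral of the measure `τ` on the line,
plus `c` times the imaginary part; the latter is the contribution of a mass `c` at infinity. -/
structure HasPoissonRep (u : ℂ → ℝ) (c : ℝ) (τ : Measure ℝ) : Prop where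
  integrable : Integrable (fun t : ℝ => (1 + t ^ 2)⁻¹) τ
  eq_add_integral : ∀ w ∈ upperHalf, u w = c * w.im + ∫ t, halfPlanePoisson w t ∂τ

theorem measureReal_sum_smul {X ι : Type*} [MeasurableSpace X] [Fintype ι] {ν : ι → Measure X}
    {Ω : Set X} (hν : ∀ i, ν i Ω ≠ ⊤) (a : ι → NNReal) :
    (∑ i, a i • ν i).real Ω = ∑ i, a i * (ν i).real Ω := by
  rw [Measure.real, Measure.finsetSum_apply, ENNReal.toReal_sum fun i _ =>
    by simp [ENNReal.mul_eq_top, hν]]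
  exact Finset.sum_congr rfl fun i _ => measureReal_nnreal_smul_apply (a i)

section IntegrableWeight

variable {τ : Measure ℝ}

theorem measure_lt_top_of_integrable_inv_one_add_sq
    (hτ : Integrable (fun t : ℝ => (1 + t ^ 2)⁻¹) τ) {Ω : Set ℝ} (hΩ : Bornology.IsBounded Ω) :
    τ Ω < ⊤ := by
  obtain ⟨K, hK⟩ := hΩ.exists_norm_le
  refine (measure_mono fun t ht => ?_).trans_lt
    (hτ.measure_ge_lt_top (show 0 < (1 + K ^ 2)⁻¹ by positivity))
  have hsq : t ^ 2 ≤ K ^ 2 :=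
    sq_le_sq' (neg_le_of_abs_le (hK t ht)) (le_of_abs_le (hK t ht))
  change (1 + K ^ 2)⁻¹ ≤ (1 + t ^ 2)⁻¹
  gcongr

theorem isLocallyFiniteMeasure_of_integrable_inv_one_add_sq
    (hτ : Integrable (fun t : ℝ => (1 + t ^ 2)⁻¹) τ) : IsLocallyFiniteMeasure τ :=
  ⟨fun t => ⟨Metric.ball t 1, Metric.ball_mem_nhds t one_pos,
    measure_lt_top_of_integrable_inv_one_add_sq hτ Metric.isBounded_ball⟩⟩

theorem integrable_halfPlanePoisson (hτ : Integrable (fun t : ℝ => (1 + t ^ 2)⁻¹) τ) {w : ℂ}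
    (hw : 0 < w.im) : Integrable (halfPlanePoisson w) τ := by
  obtain ⟨C, hC⟩ := exists_halfPlanePoisson_le |w.re| hw
  refine (hτ.const_mul C).mono' (continuous_halfPlanePoisson hw).aestronglyMeasurable
    (.of_forall fun t => ?_)
  rw [Real.norm_of_nonneg (halfPlanePoisson_nonneg hw.le t)]
  exact hC w.re le_rfl t

theorem integrable_mul_halfPlanePoisson_prod [SFinite τ]
    (hτ : Integrable (fun t : ℝ => (1 + t ^ 2)⁻¹) τ)
    {g : ℝ → ℝ} (hg : Continuous g) (hc : HasCompactSupport g) {y : ℝ} (hy : 0 < y) :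
    Integrable (fun p : ℝ × ℝ => g p.1 * halfPlanePoisson ⟨p.1, y⟩ p.2) (volume.prod τ) := by
  obtain ⟨K, hK⟩ := hc.isBounded.exists_norm_le
  obtain ⟨C, hC⟩ := exists_halfPlanePoisson_le K hy
  have hgi : Integrable g := hg.integrable_of_hasCompactSupport hc
  refine (hgi.norm.mul_prod (hτ.const_mul C)).mono'
    ((hg.comp continuous_fst).mul (continuous_halfPlanePoisson_mk hy)).aestronglyMeasurable
    (.of_forall fun ⟨s, t⟩ => ?_)
  rw [norm_mul, Real.norm_of_nonneg (halfPlanePoisson_nonneg hy.le t)]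
  by_cases hs : s ∈ tsupport g
  · exact mul_le_mul_of_nonneg_left (hC s (hK s hs) t) (norm_nonneg _)
  · simp only [image_eq_zero_of_notMem_tsupport hs, norm_zero, zero_mul, le_refl]

end IntegrableWeight

namespace HasPoissonRep

variable {u : ℂ → ℝ} {c : ℝ} {τ : Measure ℝ}

theorem add {u' : ℂ → ℝ} {c' : ℝ} {τ' : Measure ℝ} (h : HasPoissonRep u c τ)
    (h' : HasPoissonRep u' c' τ') : HasPoissonRep (fun w => u w + u' w) (c + c') (τ + τ') where
  integrable := h.integrable.add_measure h'.integrable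
  eq_add_integral w hw := by
    rw [integral_add_measure (integrable_halfPlanePoisson h.integrable hw)
      (integrable_halfPlanePoisson h'.integrable hw), h.eq_add_integral w hw,
      h'.eq_add_integral w hw]
    ring

theorem sum_smul {ι : Type*} [Fintype ι] {u : ι → ℂ → ℝ} {c : ι → ℝ} {τ : ι → Measure ℝ}
    (h : ∀ i, HasPoissonRep (u i) (c i) (τ i)) (a : ι → NNReal) :
    HasPoissonRep (fun w => ∑ i, a i * u i w) (∑ i, a i * c i) (∑ i, a i • τ i) where
  integrable := integrable_finsetSum_measure.2 fun i _ => (h i).integrable.smul_measure_nnreal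
  eq_add_integral w hw := by
    rw [integral_finsetSum_measure fun i _ =>
      (integrable_halfPlanePoisson (h i).integrable hw).smul_measure_nnreal, Finset.sum_mul,
      ← Finset.sum_add_distrib]
    refine Finset.sum_congr rfl fun i _ => ?_
    rw [(h i).eq_add_integral w hw, integral_smul_nnreal_measure, NNReal.smul_def, smul_eq_mul]
    ring

theorem stieltjes_inversion (h : HasPoissonRep u c τ) {g : ℝ → ℝ} (hg : Continuous g)
    (hc : HasCompactSupport g) :
    Tendsto (fun y => ∫ s, g s * u ⟨s, y⟩) (𝓝[>] 0) (𝓝 (∫ t, g t ∂τ)) := by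
  have := isLocallyFiniteMeasure_of_integrable_inv_one_add_sq h.integrable
  have hgi : Integrable g := hg.integrable_of_hasCompactSupport hc
  have hswap : ∀ y > 0, ∫ s, g s * u ⟨s, y⟩ =
      (c * y * ∫ s, g s) + ∫ t, (∫ s, g s * halfPlanePoisson ⟨s, y⟩ t) ∂τ := by
    intro y hy
    have hprod := integrable_mul_halfPlanePoisson_prod h.integrable hg hc hy
    rw [← integral_integral_swap hprod, ← integral_const_mul,
      ← integral_add (hgi.const_mul _) hprod.integral_prod_left]
    refine integral_congr_ae (.of_forall fun s => ?_)
    simp only [h.eq_add_integral ⟨s, y⟩ hy, integral_const_mul]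
    ring
  have hlinear : Tendsto (fun y => c * y * ∫ s, g s) (𝓝[>] 0) (𝓝 0) :=
    tendsto_nhdsWithin_of_tendsto_nhds (Continuous.tendsto' (by fun_prop) _ _ (by simp))
  obtain ⟨C, hC⟩ := exists_abs_integral_mul_halfPlanePoisson_le hg hc
  have hpoisson : Tendsto (fun y => ∫ t, (∫ s, g s * halfPlanePoisson ⟨s, y⟩ t) ∂τ) (𝓝[>] 0)
      (𝓝 (∫ t, g t ∂τ)) := by
    refine tendsto_integral_filter_of_dominated_convergence _ ?_ ?_ (h.integrable.const_mul C)
      (.of_forall fun t => tendsto_integral_mul_halfPlanePoisson hgi hg.continuousAt)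
    · filter_upwards [self_mem_nhdsWithin] with y hy
      exact (integrable_mul_halfPlanePoisson_prod h.integrable hg hc
        hy).integral_prod_right.aestronglyMeasurable
    · filter_upwards [Ioc_mem_nhdsGT one_pos] with y hy
      exact .of_forall (hC y hy)
  refine (by simpa using hlinear.add hpoisson : Tendsto _ _ _).congr' ?_
  filter_upwards [self_mem_nhdsWithin] with y hy
  exact (hswap y hy).symm

theorem unique {c' : ℝ} {τ' : Measure ℝ} (h : HasPoissonRep u c τ) (h' : HasPoissonRep u c' τ') :
    c = c' ∧ τ = τ' := by
  have := isLocallyFiniteMeasure_of_integrable_inv_one_add_sq h.integrable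
  have := isLocallyFiniteMeasure_of_integrable_inv_one_add_sq h'.integrable
  have hτ : τ = τ' := Measure.ext_of_integral_eq_on_compactlySupported fun g =>
    tendsto_nhds_unique (h.stieltjes_inversion g.continuous g.hasCompactSupport)
      (h'.stieltjes_inversion g.continuous g.hasCompactSupport)
  refine ⟨?_, hτ⟩
  have hI := (h.eq_add_integral Complex.I (by simp [upperHalf])).symm.trans
    (h'.eq_add_integral Complex.I (by simp [upperHalf]))
  rw [hτ] at hI
  simpa using hI

theorem congr {u' : ℂ → ℝ} (h : HasPoissonRep u c τ) (hu : ∀ w ∈ upperHalf, u' w = u w) :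
    HasPoissonRep u' c τ :=
  ⟨h.integrable, fun w hw => (hu w hw).trans (h.eq_add_integral w hw)⟩

theorem eq_sum {ι : Type*} [Fintype ι] {v : ι → ℂ → ℝ} {b : ι → ℝ} {ν : ι → Measure ℝ}
    (h : HasPoissonRep u c τ) (hv : ∀ i, HasPoissonRep (v i) (b i) (ν i)) {a : ι → ℝ}
    (hu : ∀ w ∈ upperHalf, u w = ∑ i, a i * v i w) :
    c = ∑ i, a i * b i ∧
      ∀ Ω, Bornology.IsBounded Ω → τ.real Ω = ∑ i, a i * (ν i).real Ω := by
  have hsplit (f : ι → ℝ) : ∑ i, a i * f i + ∑ i, ((-a i).toNNReal : ℝ) * f i =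
      ∑ i, ((a i).toNNReal : ℝ) * f i := by
    rw [← Finset.sum_add_distrib]
    refine Finset.sum_congr rfl fun i _ => ?_
    have hi := max_zero_sub_max_neg_zero_eq_self (a i)
    rw [Real.coe_toNNReal', Real.coe_toNNReal']
    linear_combination -f i * hi
  obtain ⟨hmass, hmeas⟩ := (h.add (sum_smul hv fun i => (-a i).toNNReal)).unique
    ((sum_smul hv fun i => (a i).toNNReal).congr fun w hw => by rw [hu w hw, hsplit])
  refine ⟨by linarith [hsplit b], fun Ω hΩ => ?_⟩
  have hfin (i : ι) : ν i Ω ≠ ⊤ :=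
    (measure_lt_top_of_integrable_inv_one_add_sq (hv i).integrable hΩ).ne
  have hreal := congrArg (Measure.real · Ω) hmeas
  rw [measureReal_add_apply (measure_lt_top_of_integrable_inv_one_add_sq h.integrable hΩ).ne
    (by simp [Measure.finsetSum_apply, ENNReal.mul_eq_top, hfin]),
    measureReal_sum_smul hfin, measureReal_sum_smul hfin] at hreal
  linarith [hsplit fun i => (ν i).real Ω]

end HasPoissonRep

section Herglotz

open Metric

/-- Normalized arc length on the unit circle. -/
def arcLength : Measure (sphere (0 : ℂ) 1) :=
  ENNReal.ofReal (2 * Real.pi)⁻¹ • (volume.restrict (Set.Ioc 0 (2 * Real.pi))).map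
    fun θ => ⟨circleMap 0 1 θ, circleMap_mem_sphere 0 zero_le_one θ⟩

instance : IsFiniteMeasure arcLength := by
  rw [arcLength]
  exact Measure.smul_finite _ ENNReal.ofReal_ne_top

theorem integral_arcLength {f : ℂ → ℝ} {r : ℝ}
    (hf : Continuous fun ζ : sphere (0 : ℂ) 1 => f (r * ζ)) :
    ∫ ζ : sphere (0 : ℂ) 1, f (r * ζ) ∂arcLength = Real.circleAverage f 0 r := by
  rw [arcLength, integral_smul_measure, integral_map (by fun_prop) hf.aestronglyMeasurable,
    ENNReal.toReal_ofReal (by positivity), Real.circleAverage_def,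
    intervalIntegral.integral_of_le Real.two_pi_pos.le]
  simp only [circleMap_zero, Complex.ofReal_one, one_mul]

theorem poissonKernel_real_mul (z ζ : ℂ) {r : ℝ} (hr : r ≠ 0) :
    poissonKernel 0 (r * z) (r * ζ) = poissonKernel 0 z ζ := by
  simp only [poissonKernel_def, sub_zero, ← mul_sub, norm_mul, mul_pow]
  exact mul_div_mul_left _ _ (by simpa using hr)

theorem continuous_poissonKernel_sphere {z : ℂ} (hz : z ∈ ball (0 : ℂ) 1) :
    Continuous fun ζ : sphere (0 : ℂ) 1 => poissonKernel 0 z ζ := by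
  simp only [poissonKernel_def, sub_zero]
  refine Continuous.div (by fun_prop) (by fun_prop) fun ζ => ?_
  have hne : (ζ : ℂ) ≠ z := fun h => by simp [← h] at hz
  simpa [sub_eq_zero] using hne

theorem poissonKernel_zero_sphere (ζ : sphere (0 : ℂ) 1) : poissonKernel 0 0 (ζ : ℂ) = 1 := by
  simp [poissonKernel_def]

variable {u : ℂ → ℝ}

theorem exists_finiteMeasure_eq_integral_poissonKernel_of_closedBall {r : ℝ} (hr : 0 < r)
    (hu : InnerProductSpace.HarmonicOnNhd u (closedBall 0 r))
    (hnonneg : ∀ z ∈ closedBall 0 r, 0 ≤ u z) :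
    ∃ ρ : FiniteMeasure (sphere (0 : ℂ) 1), ∀ z ∈ ball (0 : ℂ) 1,
      u (r * z) = ∫ ζ : sphere (0 : ℂ) 1, poissonKernel 0 z ζ ∂ρ.toMeasure := by
  have hmem (ζ : sphere (0 : ℂ) 1) : (r * ζ : ℂ) ∈ closedBall (0 : ℂ) r := by
    simp [abs_of_pos hr]
  have hcont : Continuous fun ζ : sphere (0 : ℂ) 1 => u (r * ζ) :=
    continuous_iff_continuousAt.2 fun ζ => ContinuousAt.comp (g := u)
      (hu _ (hmem ζ)).1.continuousAt (by fun_prop)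
  let d : C(sphere (0 : ℂ) 1, NNReal) :=
    ⟨fun ζ => (u (r * ζ)).toNNReal, continuous_real_toNNReal.comp hcont⟩
  have hfin : IsFiniteMeasure (arcLength.withDensity fun ζ => (d ζ : ENNReal)) :=
    isFiniteMeasure_withDensity <| (BoundedContinuousFunction.lintegral_lt_top_of_nnreal
      arcLength (.mkOfCompact d)).ne
  refine ⟨⟨_, hfin⟩, fun z hz => ?_⟩
  have hrz : (r * z : ℂ) ∈ ball (0 : ℂ) r := by
    simpa [abs_of_pos hr, hr] using hz
  rw [FiniteMeasure.toMeasure_mk, integral_withDensity_eq_integral_smul d.continuous.measurable,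
    ← hu.circleAverage_poissonKernel_smul hrz, ← integral_arcLength]
  · refine integral_congr_ae (.of_forall fun ζ => ?_)
    simp only [d, ContinuousMap.coe_mk, Pi.smul_apply', poissonKernel_real_mul _ _ hr.ne',
      NNReal.smul_def, Real.coe_toNNReal _ (hnonneg _ (hmem ζ)), smul_eq_mul]
    exact mul_comm _ _
  · simp only [Pi.smul_apply', poissonKernel_real_mul _ _ hr.ne', smul_eq_mul]
    exact (continuous_poissonKernel_sphere hz).mul hcont

/-- **Herglotz's theorem**: the boundary measure is a weak cluster point, as `r → 1`, of the
boundary values on the circles of radius `r`, all of which have mass `u 0`. -/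
theorem exists_finiteMeasure_eq_integral_poissonKernel
    (hu : InnerProductSpace.HarmonicOnNhd u (ball 0 1)) (hnonneg : ∀ z ∈ ball 0 1, 0 ≤ u z) :
    ∃ σ : FiniteMeasure (sphere (0 : ℂ) 1), ∀ z ∈ ball (0 : ℂ) 1,
      u z = ∫ ζ : sphere (0 : ℂ) 1, poissonKernel 0 z ζ ∂σ.toMeasure := by
  have hdilate : ∀ r ∈ Set.Ioo (0 : ℝ) 1, ∃ ρ : FiniteMeasure (sphere (0 : ℂ) 1),
      ∀ z ∈ ball (0 : ℂ) 1, u (r * z) = ∫ ζ : sphere (0 : ℂ) 1, poissonKernel 0 z ζ ∂ρ.toMeasure :=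
    fun r hr => exists_finiteMeasure_eq_integral_poissonKernel_of_closedBall hr.1
      (hu.mono (closedBall_subset_ball hr.2))
      fun z hz => hnonneg z (closedBall_subset_ball hr.2 hz)
  choose! ρ hρ using hdilate
  have hmass : ∀ r ∈ Set.Ioo (0 : ℝ) 1, (ρ r).mass = (u 0).toNNReal := by
    intro r hr
    have h0 := hρ r hr 0 (by simp)
    simp only [mul_zero, poissonKernel_zero_sphere, integral_const, smul_eq_mul, mul_one] at h0
    rw [h0]
    exact Real.toNNReal_coe.symm
  obtain ⟨σ, -, hσ⟩ := (isCompact_setOfPred_finiteMeasure_eq_of_compactSpace (sphere (0 : ℂ) 1)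
    (u 0).toNNReal).exists_mapClusterPt (f := 𝓝[<] (1 : ℝ)) (u := ρ)
    (le_principal_iff.2 (mem_map.2 <| mem_of_superset (Ioo_mem_nhdsLT zero_lt_one) hmass))
  refine ⟨σ, fun z hz => ?_⟩
  let P : BoundedContinuousFunction (sphere (0 : ℂ) 1) ℝ :=
    .mkOfCompact ⟨fun ζ => poissonKernel 0 z ζ, continuous_poissonKernel_sphere hz⟩
  have hcluster : MapClusterPt (∫ ζ, P ζ ∂σ.toMeasure) (𝓝[<] (1 : ℝ))
      fun r => ∫ ζ, P ζ ∂(ρ r).toMeasure :=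
    hσ.tendsto_comp (FiniteMeasure.tendsto_iff_forall_integral_tendsto.1 tendsto_id P)
  have hradial : Tendsto (fun r => ∫ ζ, P ζ ∂(ρ r).toMeasure) (𝓝[<] (1 : ℝ)) (𝓝 (u z)) := by
    have hlim : ContinuousAt (fun r : ℝ => u (r * z)) 1 :=
      ContinuousAt.comp (g := u) (by simpa using (hu z hz).1.continuousAt) (by fun_prop)
    have hlim' : Tendsto (fun r : ℝ => u (r * z)) (𝓝[<] (1 : ℝ)) (𝓝 (u z)) := by
      simpa using hlim.tendsto.mono_left nhdsWithin_le_nhds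
    refine hlim'.congr' ?_
    filter_upwards [Ioo_mem_nhdsLT zero_lt_one] with r hr
    exact hρ r hr z hz
  exact (eq_of_nhds_neBot (hcluster.neBot.mono (inf_le_inf_left _ hradial))).symm

end Herglotz

section Cayley

open Metric

/-- The Cayley transform, a conformal map of the upper half-plane onto the unit disk. -/
def cayley (w : ℂ) : ℂ := (w - Complex.I) / (w + Complex.I)

/-- The inverse Cayley transform, a conformal map of the unit disk onto the upper half-plane; it
maps the unit circle without `1` onto the real line. -/
def cayleyInv (z : ℂ) : ℂ := Complex.I * (1 + z) / (1 - z)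

theorem cayleyInv_im (z : ℂ) : (cayleyInv z).im = (1 - ‖z‖ ^ 2) / ‖1 - z‖ ^ 2 := by
  rw [cayleyInv, Complex.div_im, Complex.sq_norm, Complex.sq_norm, Complex.normSq_apply z]
  simp only [Complex.mul_im, Complex.mul_re, Complex.add_im, Complex.add_re, Complex.sub_re,
    Complex.sub_im, Complex.one_re, Complex.one_im, Complex.I_re, Complex.I_im]
  ring

theorem cayley_cayleyInv {z : ℂ} (hz : z ≠ 1) : cayley (cayleyInv z) = z := by
  have h : 1 - z ≠ 0 := sub_ne_zero.2 hz.symm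
  have hI := Complex.I_ne_zero
  rw [cayley, cayleyInv]
  field_simp
  ring

theorem add_I_ne_zero {w : ℂ} (hw : 0 ≤ w.im) : w + Complex.I ≠ 0 := fun h => by
  have him := congrArg Complex.im h
  simp only [Complex.add_im, Complex.I_im, Complex.zero_im] at him
  linarith

theorem cayleyInv_cayley {w : ℂ} (hw : w + Complex.I ≠ 0) : cayleyInv (cayley w) = w := by
  rw [cayleyInv, cayley]
  field_simp
  ring

theorem one_sub_cayley {w : ℂ} (hw : w + Complex.I ≠ 0) :
    1 - cayley w = 2 * Complex.I / (w + Complex.I) := by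
  rw [cayley]
  field_simp
  ring

theorem one_sub_norm_cayley_sq {w : ℂ} (hw : w + Complex.I ≠ 0) :
    1 - ‖cayley w‖ ^ 2 = 4 * w.im / ‖w + Complex.I‖ ^ 2 := by
  have hpos : ‖w + Complex.I‖ ^ 2 ≠ 0 := by simpa using hw
  rw [cayley, norm_div, div_pow, eq_div_iff hpos, sub_mul, div_mul_cancel₀ _ hpos]
  simp only [Complex.sq_norm, Complex.normSq_apply, Complex.add_re, Complex.add_im,
    Complex.sub_re, Complex.sub_im, Complex.I_re, Complex.I_im]
  ring

theorem cayley_mem_ball {w : ℂ} (hw : w ∈ upperHalf) : cayley w ∈ ball (0 : ℂ) 1 := by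
  have hne := add_I_ne_zero (le_of_lt hw)
  have hpos : 0 < 1 - ‖cayley w‖ ^ 2 := by
    rw [one_sub_norm_cayley_sq hne]
    have : 0 < w.im := hw
    positivity
  rw [mem_ball_zero_iff, ← sq_lt_one_iff₀ (norm_nonneg _)]
  linarith

theorem cayleyInv_mem_upperHalf {z : ℂ} (hz : z ∈ ball (0 : ℂ) 1) : cayleyInv z ∈ upperHalf := by
  rw [mem_ball_zero_iff] at hz
  have hne : 1 - z ≠ 0 := sub_ne_zero.2 fun h => by simp [← h] at hz
  change 0 < (cayleyInv z).im
  rw [cayleyInv_im]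
  have : 0 < 1 - ‖z‖ ^ 2 := by nlinarith [norm_nonneg z]
  positivity

theorem differentiableOn_cayleyInv : DifferentiableOn ℂ cayleyInv (ball 0 1) := by
  unfold cayleyInv
  refine DifferentiableOn.div (by fun_prop) (by fun_prop) fun z hz => sub_ne_zero.2 fun h => ?_
  simp [← h] at hz

theorem norm_cayley_real (t : ℝ) : ‖cayley t‖ = 1 := by
  have hsq : 1 - ‖cayley t‖ ^ 2 = 0 := by
    simp [one_sub_norm_cayley_sq (add_I_ne_zero (w := t) (by simp))]
  exact (pow_eq_one_iff_of_nonneg (norm_nonneg _) two_ne_zero).1 (sub_eq_zero.1 hsq).symm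

theorem cayley_re_cayleyInv {ζ : ℂ} (hζ : ‖ζ‖ = 1) (hne : ζ ≠ 1) :
    cayley (cayleyInv ζ).re = ζ := by
  have hreal : ((cayleyInv ζ).re : ℂ) = cayleyInv ζ :=
    Complex.ext rfl (by simp [cayleyInv_im, hζ])
  rw [hreal, cayley_cayleyInv hne]

theorem poissonKernel_cayley_one {w : ℂ} (hw : w + Complex.I ≠ 0) :
    poissonKernel 0 (cayley w) 1 = w.im := by
  simp only [poissonKernel_def, sub_zero, norm_one, one_pow, one_sub_norm_cayley_sq hw,
    one_sub_cayley hw, norm_div, norm_mul, Complex.norm_I, Complex.norm_ofNat, div_pow]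
  field_simp
  ring

theorem poissonKernel_cayley_real {w : ℂ} (hw : w + Complex.I ≠ 0) (t : ℝ) :
    poissonKernel 0 (cayley w) (cayley t) = Real.pi * (1 + t ^ 2) * halfPlanePoisson w t := by
  have ht : (t : ℂ) + Complex.I ≠ 0 := add_I_ne_zero (by simp)
  have hsub : cayley t - cayley w =
      2 * Complex.I * (t - w) / ((t + Complex.I) * (w + Complex.I)) := by
    rw [cayley, cayley]
    field_simp
    ring
  have htI : ‖(t : ℂ) + Complex.I‖ ^ 2 = 1 + t ^ 2 := by
    simp only [Complex.sq_norm, Complex.normSq_apply, Complex.add_re, Complex.add_im,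
      Complex.ofReal_re, Complex.ofReal_im, Complex.I_re, Complex.I_im]
    ring
  have htw : ‖(t : ℂ) - w‖ ^ 2 = (t - w.re) ^ 2 + w.im ^ 2 := by
    simp only [Complex.sq_norm, Complex.normSq_apply, Complex.sub_re, Complex.sub_im,
      Complex.ofReal_re, Complex.ofReal_im]
    ring
  rw [poissonKernel_def, sub_zero, sub_zero, norm_cayley_real, one_pow, one_sub_norm_cayley_sq hw,
    hsub, norm_div, norm_mul, norm_mul, norm_mul, div_pow, mul_pow, mul_pow, mul_pow, htI, htw,
    halfPlanePoisson_eq, Complex.norm_ofNat, Complex.norm_I]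
  field_simp
  ring

/-- The measure on the line whose Poisson integral is that of `σ` on the disk, up to the mass of
`σ` at `1`, which the Cayley transform sends to infinity. -/
def lineMeasure (σ : Measure (sphere (0 : ℂ) 1)) : Measure ℝ :=
  ((σ.restrict {1}ᶜ).map fun ζ : sphere (0 : ℂ) 1 => (cayleyInv ζ).re).withDensity
    fun t => (Real.pi * (1 + t ^ 2)).toNNReal

theorem hasPoissonRep_integral_poissonKernel_cayley (σ : Measure (sphere (0 : ℂ) 1))
    [IsFiniteMeasure σ] :
    HasPoissonRep (fun w => ∫ ζ : sphere (0 : ℂ) 1, poissonKernel 0 (cayley w) ζ ∂σ) (σ.real {1})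
      (lineMeasure σ) := by
  have hmeas : Measurable fun ζ : sphere (0 : ℂ) 1 => (cayleyInv ζ).re := by
    unfold cayleyInv
    fun_prop
  have hdens : Measurable fun t : ℝ => (Real.pi * (1 + t ^ 2)).toNNReal := by fun_prop
  have hcoe (t : ℝ) : ((Real.pi * (1 + t ^ 2)).toNNReal : ℝ) = Real.pi * (1 + t ^ 2) :=
    Real.coe_toNNReal _ (by positivity)
  refine ⟨?_, fun w hw => ?_⟩
  · rw [lineMeasure, integrable_withDensity_iff_integrable_smul hdens]
    refine (integrable_const Real.pi).congr (.of_forall fun t => ?_)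
    simp only [NNReal.smul_def, hcoe, smul_eq_mul]
    field_simp
  · have hwI := add_I_ne_zero (le_of_lt hw)
    have hline : ∫ t, halfPlanePoisson w t ∂lineMeasure σ =
        ∫ ζ in {1}ᶜ, poissonKernel 0 (cayley w) ζ ∂σ := by
      rw [lineMeasure, integral_withDensity_eq_integral_smul hdens,
        integral_map hmeas.aemeasurable (by
          exact (hdens.smul (continuous_halfPlanePoisson hw).measurable).aestronglyMeasurable)]
      refine setIntegral_congr_fun (measurableSet_singleton 1).compl fun ζ hζ => ?_
      rw [NNReal.smul_def, hcoe, smul_eq_mul, ← poissonKernel_cayley_real hwI,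
        cayley_re_cayleyInv (by simp) fun h => hζ (Subtype.ext h)]
    have hinteg : Integrable (fun ζ : sphere (0 : ℂ) 1 => poissonKernel 0 (cayley w) ζ) σ :=
      (continuous_poissonKernel_sphere (cayley_mem_ball hw)).integrable_of_hasCompactSupport
        (.of_compactSpace _)
    rw [hline, ← integral_add_compl (measurableSet_singleton 1) hinteg, integral_singleton]
    simp [poissonKernel_cayley_one hwI]

theorem exists_hasPoissonRep_re {h : ℂ → ℂ} (hh : DifferentiableOn ℂ h upperHalf)
    (hnonneg : ∀ w ∈ upperHalf, 0 ≤ (h w).re) :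
    ∃ c τ, 0 ≤ c ∧ HasPoissonRep (fun w => (h w).re) c τ := by
  have hdiff : DifferentiableOn ℂ (h ∘ cayleyInv) (ball 0 1) :=
    hh.comp differentiableOn_cayleyInv fun z hz => cayleyInv_mem_upperHalf hz
  have hharm : InnerProductSpace.HarmonicOnNhd (fun z => (h (cayleyInv z)).re) (ball 0 1) :=
    fun z hz => (hdiff.analyticAt (isOpen_ball.mem_nhds hz)).harmonicAt_re
  obtain ⟨σ, hσ⟩ := exists_finiteMeasure_eq_integral_poissonKernel hharm
    fun z hz => hnonneg _ (cayleyInv_mem_upperHalf hz)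
  refine ⟨σ.toMeasure.real {1}, lineMeasure σ, measureReal_nonneg,
    (hasPoissonRep_integral_poissonKernel_cayley σ.toMeasure).congr fun w hw => ?_⟩
  rw [← hσ _ (cayley_mem_ball hw), cayleyInv_cayley (add_I_ne_zero (le_of_lt hw))]

end Cayley

section QuadraticForm

variable {n : ℕ}

theorem qform_smul (r : ℝ) (M : Matrix (Fin n) (Fin n) ℂ) (x : Fin n → ℂ) :
    qform (r • M) x = r * qform M x := by
  simp [qform, Matrix.smul_mulVec, dotProduct_smul]

theorem qform_add (M N : Matrix (Fin n) (Fin n) ℂ) (x : Fin n → ℂ) :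
    qform (M + N) x = qform M x + qform N x := by
  simp [qform, Matrix.add_mulVec, dotProduct_add]

theorem qform_sum_smul {ι : Type*} [Fintype ι] (r : ι → ℝ) (N : ι → Matrix (Fin n) (Fin n) ℂ)
    (x : Fin n → ℂ) : qform (∑ i, r i • N i) x = ∑ i, r i * qform (N i) x := by
  simp [qform, Matrix.sum_mulVec, dotProduct_sum, Matrix.smul_mulVec]

theorem qform_conjTranspose (M : Matrix (Fin n) (Fin n) ℂ) (x : Fin n → ℂ) :
    qform Mᴴ x = qform M x := by
  rw [qform, qform, Matrix.star_dotProduct, Matrix.star_mulVec, Matrix.conjTranspose_conjTranspose,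
    ← Matrix.dotProduct_mulVec, Complex.star_def, Complex.conj_re]

theorem qform_conj (R M : Matrix (Fin n) (Fin n) ℂ) (x : Fin n → ℂ) :
    qform (Rᴴ * M * R) x = qform M (R *ᵥ x) := by
  rw [qform, qform, Matrix.mul_assoc, ← Matrix.mulVec_mulVec, ← Matrix.mulVec_mulVec,
    Matrix.dotProduct_mulVec, Matrix.star_mulVec]

theorem qform_single_add_single (M : Matrix (Fin n) (Fin n) ℂ) (j k : Fin n) (a b : ℂ) :
    qform M (Pi.single j a + Pi.single k b) =
      (star a * M j j * a + star a * M j k * b + star b * M k j * a + star b * M k k * b).re := by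
  simp only [qform, star_add, ← Pi.single_star, Matrix.mulVec_add, add_dotProduct,
    dotProduct_add, Matrix.mulVec_single, single_dotProduct, Pi.smul_apply, Matrix.col_apply,
    MulOpposite.smul_eq_mul_unop, MulOpposite.unop_op]
  congr 1
  ring

theorem posSemidef_of_isHermitian_of_qform_nonneg {M : Matrix (Fin n) (Fin n) ℂ}
    (hM : M.IsHermitian) (h : ∀ x, 0 ≤ qform M x) : M.PosSemidef :=
  .of_dotProduct_mulVec_nonneg hM fun x =>
    Complex.nonneg_iff.2 ⟨h x, (hM.im_star_dotProduct_mulVec_self x).symm⟩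

/-- The vectors of the polarization identity: a quadratic form is determined by its values at
`e_j + i ^ l e_k`. -/
def polarVec (p : Fin n × Fin n × Fin 4) : Fin n → ℂ :=
  Pi.single p.1 1 + Pi.single p.2.1 (Complex.I ^ (p.2.2 : ℕ))

/-- The Hermitian matrices dual to `polarVec`, that is, the coefficients of the polarization
identity. -/
def polarMatrix (p : Fin n × Fin n × Fin 4) : Matrix (Fin n) (Fin n) ℂ :=
  Matrix.single p.2.1 p.1 (Complex.I ^ (p.2.2 : ℕ) / 8) +
    (Matrix.single p.2.1 p.1 (Complex.I ^ (p.2.2 : ℕ) / 8))ᴴ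

theorem isHermitian_polarMatrix (p : Fin n × Fin n × Fin 4) : (polarMatrix p).IsHermitian := by
  rw [Matrix.IsHermitian, polarMatrix, Matrix.conjTranspose_add,
    Matrix.conjTranspose_conjTranspose, add_comm]

theorem isHermitian_sum_smul_polarMatrix (r : Fin n × Fin n × Fin 4 → ℝ) :
    (∑ p, r p • polarMatrix p).IsHermitian := by
  simp only [Matrix.IsHermitian, Matrix.conjTranspose_sum, Matrix.conjTranspose_smul, star_trivial,
    (isHermitian_polarMatrix _).eq]

theorem sum_qform_polarVec_mul (M : Matrix (Fin n) (Fin n) ℂ) (j k : Fin n) :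
    ∑ l : Fin 4, (qform M (polarVec (j, k, l)) : ℂ) * (Complex.I ^ (l : ℕ) / 8) =
      (M k j + Mᴴ k j) / 4 := by
  simp only [polarVec, qform_single_add_single, Fin.sum_univ_four, Matrix.conjTranspose_apply]
  apply Complex.ext <;> simp [pow_succ] <;> ring

theorem sum_qform_smul_polarMatrix (M : Matrix (Fin n) (Fin n) ℂ) :
    ∑ p, qform M (polarVec p) • polarMatrix p = (1 / 2 : ℝ) • (M + Mᴴ) := by
  let S := ∑ p : Fin n × Fin n × Fin 4, qform M (polarVec p) •
    Matrix.single p.2.1 p.1 (Complex.I ^ (p.2.2 : ℕ) / 8)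
  have hS : S = (1 / 4 : ℝ) • (M + Mᴴ) := by
    have hsingle (j k : Fin n) (f : Fin 4 → ℂ) :
        ∑ l, Matrix.single k j (f l) = Matrix.single k j (∑ l, f l) :=
      (map_sum (Matrix.singleAddMonoidHom k j) f Finset.univ).symm
    simp only [S, Fintype.sum_prod_type, Matrix.smul_single, Complex.real_smul, hsingle,
      sum_qform_polarVec_mul]
    rw [Finset.sum_comm, Matrix.matrix_eq_sum_single ((1 / 4 : ℝ) • (M + Mᴴ))]
    simp [div_eq_inv_mul, mul_add]
  calc ∑ p, qform M (polarVec p) • polarMatrix p = S + Sᴴ := by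
        simp only [S, polarMatrix, smul_add, Finset.sum_add_distrib, Matrix.conjTranspose_sum,
          Matrix.conjTranspose_smul, star_trivial]
    _ = (1 / 2 : ℝ) • (M + Mᴴ) := by
        rw [hS, Matrix.conjTranspose_smul, star_trivial, Matrix.conjTranspose_add,
          Matrix.conjTranspose_conjTranspose, add_comm Mᴴ M, ← add_smul]
        norm_num

theorem sum_qform_smul_polarMatrix_of_isHermitian {M : Matrix (Fin n) (Fin n) ℂ}
    (hM : M.IsHermitian) : ∑ p, qform M (polarVec p) • polarMatrix p = M := by
  rw [sum_qform_smul_polarMatrix, hM.eq, ← two_smul ℝ M, smul_smul]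
  norm_num

theorem qform_eq_sum_polar (M : Matrix (Fin n) (Fin n) ℂ) (x : Fin n → ℂ) :
    qform M x = ∑ p, qform (polarMatrix p) x * qform M (polarVec p) := by
  have h := congrArg (qform · x) (sum_qform_smul_polarMatrix M)
  simp only [qform_sum_smul, qform_smul, qform_add, qform_conjTranspose] at h
  simp only [mul_comm (qform (polarMatrix _) x), h]
  ring

end QuadraticForm

theorem hasSum_measureReal {X ι : Type*} [MeasurableSpace X] [Countable ι] {ν : Measure X}
    {f : ι → Set X} (hm : ∀ i, MeasurableSet (f i)) (hd : Pairwise (Function.onFun Disjoint f))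
    (hν : ν (⋃ i, f i) ≠ ⊤) : HasSum (fun i => ν.real (f i)) (ν.real (⋃ i, f i)) := by
  rw [measure_iUnion hd hm] at hν
  rw [Measure.real, measure_iUnion hd hm, ENNReal.tsum_toReal_eq (ENNReal.ne_top_of_tsum_ne_top hν)]
  exact ENNReal.hasSum_toReal hν

namespace MatrixMeasure

variable {n : ℕ}

theorem real_scalar (μ : MatrixMeasure n) (x : Fin n → ℂ) {Ω : Set ℝ} (hm : MeasurableSet Ω)
    (hb : Bornology.IsBounded Ω) : (μ.scalar x).real Ω = qform (μ Ω) x := by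
  rw [Measure.real, μ.scalar_apply x hm hb, ENNReal.toReal_ofReal (μ.qform_nonneg x hm hb)]

theorem ext_of_scalar_eq {μ ν : MatrixMeasure n} (h : ∀ x, μ.scalar x = ν.scalar x) : μ = ν := by
  suffices hfun : μ.toFun = ν.toFun by
    cases μ
    cases ν
    congr
  funext Ω
  by_cases hΩ : MeasurableSet Ω ∧ Bornology.IsBounded Ω
  · rw [← sum_qform_smul_polarMatrix_of_isHermitian (μ.posSemidef' Ω hΩ.1 hΩ.2).isHermitian,
      ← sum_qform_smul_polarMatrix_of_isHermitian (ν.posSemidef' Ω hΩ.1 hΩ.2).isHermitian]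
    simp only [← real_scalar _ _ hΩ.1 hΩ.2, h]
  · rw [μ.eq_zero' Ω hΩ, ν.eq_zero' Ω hΩ]

theorem scalar_eq {μ : MatrixMeasure n} {x : Fin n → ℂ} {τ : Measure ℝ}
    (h : ∀ Ω, MeasurableSet Ω → Bornology.IsBounded Ω → τ Ω = ENNReal.ofReal (qform (μ Ω) x)) :
    μ.scalar x = τ := by
  ext Ω hΩ
  have hm (k : ℕ) : MeasurableSet (Ω ∩ shell k) := hΩ.inter (measurableSet_shell k)
  have hb (k : ℕ) : Bornology.IsBounded (Ω ∩ shell k) :=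
    (isBounded_shell k).subset Set.inter_subset_right
  have hd : Pairwise (Function.onFun Disjoint fun k => Ω ∩ shell k) := fun i j hij =>
    (disjoint_shell hij).mono Set.inter_subset_right Set.inter_subset_right
  rw [← iUnion_inter_shell Ω, measure_iUnion hd hm, measure_iUnion hd hm]
  exact tsum_congr fun k => by rw [scalar_apply _ _ (hm k) (hb k), h _ (hm k) (hb k)]

open Classical in
theorem exists_scalar_eq {τ : (Fin n → ℂ) → Measure ℝ}
    (hfin : ∀ x Ω, Bornology.IsBounded Ω → τ x Ω < ⊤)
    (hquad : ∀ x Ω, Bornology.IsBounded Ω →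
      (τ x).real Ω = ∑ p, qform (polarMatrix p) x * (τ (polarVec p)).real Ω) :
    ∃ μ : MatrixMeasure n, ∀ x, μ.scalar x = τ x := by
  let m (Ω : Set ℝ) : Matrix (Fin n) (Fin n) ℂ := ∑ p, (τ (polarVec p)).real Ω • polarMatrix p
  have hqform {Ω : Set ℝ} (hb : Bornology.IsBounded Ω) (x) : qform (m Ω) x = (τ x).real Ω := by
    simp only [m, qform_sum_smul, hquad x Ω hb, mul_comm]
  have hsum (f : ℕ → Set ℝ) (hm : ∀ k, MeasurableSet (f k))
      (hd : Pairwise (Function.onFun Disjoint f)) (hb : Bornology.IsBounded (⋃ k, f k)) :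
      HasSum (fun k => m (f k)) (m (⋃ k, f k)) :=
    hasSum_sum fun p _ => (hasSum_measureReal hm hd (hfin _ _ hb).ne).smul_const _
  let μ : MatrixMeasure n :=
    { toFun := fun Ω => if MeasurableSet Ω ∧ Bornology.IsBounded Ω then m Ω else 0
      posSemidef' := fun Ω hm hb => by
        rw [if_pos ⟨hm, hb⟩]
        exact posSemidef_of_isHermitian_of_qform_nonneg (isHermitian_sum_smul_polarMatrix _)
          fun x => (hqform hb x).symm ▸ measureReal_nonneg
      hasSum' := fun f hm hd hb => by
        have hbk (k : ℕ) : Bornology.IsBounded (f k) := hb.subset (Set.subset_iUnion f k)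
        simpa only [hm, hbk, hb, MeasurableSet.iUnion hm, and_self, if_true] using hsum f hm hd hb
      eq_zero' := fun Ω hΩ => if_neg hΩ }
  refine ⟨μ, fun x => scalar_eq fun Ω hm hb => ?_⟩
  have hμ : μ Ω = m Ω := if_pos ⟨hm, hb⟩
  rw [hμ, hqform hb, ofReal_measureReal (hfin x Ω hb).ne]

/-- The matrix-valued measure `Ω ↦ Rᴴ * μ Ω * R`. -/
def conj (μ : MatrixMeasure n) (R : Matrix (Fin n) (Fin n) ℂ) : MatrixMeasure n where
  toFun Ω := Rᴴ * μ Ω * R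
  posSemidef' Ω hm hb := (μ.posSemidef' Ω hm hb).conjTranspose_mul_mul_same R
  hasSum' f hm hd hb := ((μ.hasSum' f hm hd hb).mul_left Rᴴ).mul_right R
  eq_zero' Ω hΩ := by rw [μ.eq_zero' Ω hΩ, Matrix.mul_zero, Matrix.zero_mul]

theorem scalar_conj (μ : MatrixMeasure n) (R : Matrix (Fin n) (Fin n) ℂ) (x : Fin n → ℂ) :
    (μ.conj R).scalar x = μ.scalar (R *ᵥ x) :=
  scalar_eq fun Ω hm hb => by
    rw [μ.scalar_apply _ hm hb]
    exact congrArg _ (qform_conj R (μ Ω) x).symm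

end MatrixMeasure

/-- `μ` is the measure of the Nevanlinna representation of `H` on the upper half-plane; the Clark
measure of `F` is the case `H = (I - F)⁻¹ (I + F)`. -/
def IsNevanlinnaMeasure {n : ℕ} (H : ℂ → Matrix (Fin n) (Fin n) ℂ) (μ : MatrixMeasure n) : Prop :=
  ∃ c : Matrix (Fin n) (Fin n) ℂ, c.PosSemidef ∧
    ∀ x, HasPoissonRep (fun w => qform (H w) x) (qform c x) (μ.scalar x)

theorem isClarkMeasure_iff {n : ℕ} {F : ℂ → Matrix (Fin n) (Fin n) ℂ} {μ : MatrixMeasure n} :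
    IsClarkMeasure F μ ↔ IsNevanlinnaMeasure (nevanlinna F) μ :=
  exists_congr fun _ => and_congr_right fun _ => forall_congr' fun _ =>
    ⟨fun h => ⟨h.1, h.2⟩, fun h => ⟨h.1, h.2⟩⟩

section IsNevanlinnaMeasure

variable {n : ℕ} {H : ℂ → Matrix (Fin n) (Fin n) ℂ}

theorem IsNevanlinnaMeasure.unique {μ ν : MatrixMeasure n} (hμ : IsNevanlinnaMeasure H μ)
    (hν : IsNevanlinnaMeasure H ν) : μ = ν := by
  obtain ⟨c, -, hc⟩ := hμ
  obtain ⟨d, -, hd⟩ := hν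
  exact MatrixMeasure.ext_of_scalar_eq fun x => ((hc x).unique (hd x)).2

theorem IsNevanlinnaMeasure.conj {G : ℂ → Matrix (Fin n) (Fin n) ℂ}
    {R : Matrix (Fin n) (Fin n) ℂ} {μ : MatrixMeasure n} (hμ : IsNevanlinnaMeasure H μ)
    (hG : ∀ w ∈ upperHalf, G w = Rᴴ * H w * R) : IsNevanlinnaMeasure G (μ.conj R) := by
  obtain ⟨c, hc, hrep⟩ := hμ
  refine ⟨Rᴴ * c * R, hc.conjTranspose_mul_mul_same R, fun x => ?_⟩
  rw [μ.scalar_conj, qform_conj]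
  exact (hrep _).congr fun w hw => by rw [hG w hw, qform_conj]

theorem differentiableOn_dotProduct_mulVec {X : Set ℂ}
    (hH : ∀ i j, DifferentiableOn ℂ (fun w => H w i j) X) (x : Fin n → ℂ) :
    DifferentiableOn ℂ (fun w => star x ⬝ᵥ (H w *ᵥ x)) X := by
  simp only [dotProduct, Matrix.mulVec]
  fun_prop

/-- **Matrix Nevanlinna representation**: by uniqueness, the measures of the scalar representations
of `qform (H ·) x` depend on `x` through the polarization identity, as `qform` does. -/
theorem exists_isNevanlinnaMeasure (hH : ∀ i j, DifferentiableOn ℂ (fun w => H w i j) upperHalf)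
    (hnonneg : ∀ w ∈ upperHalf, ∀ x, 0 ≤ qform (H w) x) : ∃ μ, IsNevanlinnaMeasure H μ := by
  choose c τ hc hτ using fun x => exists_hasPoissonRep_re
    (differentiableOn_dotProduct_mulVec hH x) (hnonneg · · x)
  have hpolar (x : Fin n → ℂ) := (hτ x).eq_sum (fun p => hτ (polarVec p)) fun w _ =>
    qform_eq_sum_polar (H w) x
  obtain ⟨μ, hμ⟩ := MatrixMeasure.exists_scalar_eq
    (fun x _ => measure_lt_top_of_integrable_inv_one_add_sq (hτ x).integrable)
    fun x => (hpolar x).2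
  let C := ∑ p, c (polarVec p) • polarMatrix p
  have hC (x : Fin n → ℂ) : qform C x = c x := by
    simp only [C, qform_sum_smul, (hpolar x).1, mul_comm]
  refine ⟨μ, C, posSemidef_of_isHermitian_of_qform_nonneg (isHermitian_sum_smul_polarMatrix _)
    fun x => (hC x).symm ▸ hc x, fun x => ?_⟩
  rw [hC, hμ]
  exact hτ x

end IsNevanlinnaMeasure

section Schur

theorem differentiableOn_matrix_det {𝕜 m : Type*} [NontriviallyNormedField 𝕜] [Fintype m]
    [DecidableEq m] {M : 𝕜 → Matrix m m 𝕜} {X : Set 𝕜}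
    (hM : ∀ i j, DifferentiableOn 𝕜 (fun w => M w i j) X) :
    DifferentiableOn 𝕜 (fun w => (M w).det) X := by
  simp only [Matrix.det_apply']
  exact DifferentiableOn.fun_sum fun σ _ =>
    (DifferentiableOn.fun_finsetProd fun i _ => hM (σ i) i).const_mul _

theorem differentiableOn_matrix_inv {𝕜 m : Type*} [NontriviallyNormedField 𝕜] [Fintype m]
    [DecidableEq m] {M : 𝕜 → Matrix m m 𝕜} {X : Set 𝕜}
    (hM : ∀ i j, DifferentiableOn 𝕜 (fun w => M w i j) X)
    (hu : ∀ w ∈ X, IsUnit (M w)) (i j : m) : DifferentiableOn 𝕜 (fun w => (M w)⁻¹ i j) X := by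
  have hadj : DifferentiableOn 𝕜 (fun w => (M w).adjugate i j) X := by
    simp only [Matrix.adjugate_apply]
    refine differentiableOn_matrix_det fun k l => ?_
    obtain rfl | hk := eq_or_ne k j
    · simp only [Matrix.updateRow_self]
      fun_prop
    · simp only [Matrix.updateRow_ne hk]
      exact hM k l
  simp only [Matrix.inv_def, Ring.inverse_eq_inv', Matrix.smul_apply, smul_eq_mul]
  exact ((differentiableOn_matrix_det hM).inv fun w hw =>
    ((Matrix.isUnit_iff_isUnit_det _).1 (hu w hw)).ne_zero).mul hadj

theorem differentiableOn_matrix_mul {𝕜 E m : Type*} [NontriviallyNormedField 𝕜]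
    [NormedAddCommGroup E] [NormedSpace 𝕜 E] [Fintype m] {M N : E → Matrix m m 𝕜} {X : Set E}
    (hM : ∀ i j, DifferentiableOn 𝕜 (fun w => M w i j) X)
    (hN : ∀ i j, DifferentiableOn 𝕜 (fun w => N w i j) X) (i j : m) :
    DifferentiableOn 𝕜 (fun w => (M w * N w) i j) X := by
  simp only [Matrix.mul_apply]
  fun_prop

variable {n : ℕ}

theorem differentiableOn_nevanlinna {F : ℂ → Matrix (Fin n) (Fin n) ℂ} {X : Set ℂ}
    (hF : ∀ i j, DifferentiableOn ℂ (fun w => F w i j) X) (hinv : ∀ w ∈ X, IsUnit (1 - F w))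
    (i j : Fin n) : DifferentiableOn ℂ (fun w => nevanlinna F w i j) X :=
  differentiableOn_matrix_mul
    (differentiableOn_matrix_inv (fun k l => (differentiableOn_const _).sub (hF k l)) hinv)
    (fun k l => (differentiableOn_const _).add (hF k l)) i j

theorem re_star_dotProduct_self {m : Type*} [Fintype m] (x : m → ℂ) :
    (star x ⬝ᵥ x).re = ‖WithLp.toLp 2 x‖ ^ 2 := by
  rw [EuclideanSpace.norm_sq_eq]
  simp [dotProduct, Complex.sq_norm, Complex.normSq_apply]

theorem re_star_mulVec_dotProduct_mulVec_le {m : Type*} [Fintype m] [DecidableEq m]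
    {A : Matrix m m ℂ} (hA : ‖Matrix.toEuclideanCLM (𝕜 := ℂ) A‖ ≤ 1) (z : m → ℂ) :
    (star (A *ᵥ z) ⬝ᵥ (A *ᵥ z)).re ≤ (star z ⬝ᵥ z).re := by
  have h := (Matrix.toEuclideanCLM (𝕜 := ℂ) A).le_of_opNorm_le hA (WithLp.toLp 2 z)
  rw [one_mul, Matrix.toEuclideanCLM_toLp] at h
  rw [re_star_dotProduct_self, re_star_dotProduct_self]
  gcongr

theorem qform_nevanlinna_nonneg {F : ℂ → Matrix (Fin n) (Fin n) ℂ} {w : ℂ}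
    (hF : ‖Matrix.toEuclideanCLM (𝕜 := ℂ) (F w)‖ ≤ 1) (hinv : IsUnit (1 - F w)) (x : Fin n → ℂ) :
    0 ≤ qform (nevanlinna F w) x := by
  have hdet := (Matrix.isUnit_iff_isUnit_det _).1 hinv
  obtain ⟨z, rfl⟩ : ∃ z, x = (1 - F w) *ᵥ z := ⟨(1 - F w)⁻¹ *ᵥ x, by
    rw [Matrix.mulVec_mulVec, Matrix.mul_nonsing_inv _ hdet, Matrix.one_mulVec]⟩
  have hcomm : (1 + F w) * (1 - F w) = (1 - F w) * (1 + F w) := by noncomm_ring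
  have hmul : nevanlinna F w *ᵥ ((1 - F w) *ᵥ z) = z + F w *ᵥ z := by
    rw [nevanlinna, Matrix.mulVec_mulVec, Matrix.mul_assoc, hcomm, ← Matrix.mul_assoc,
      Matrix.nonsing_inv_mul _ hdet, Matrix.one_mul, Matrix.add_mulVec, Matrix.one_mulVec]
  have hcross : (star (F w *ᵥ z) ⬝ᵥ z).re = (star z ⬝ᵥ (F w *ᵥ z)).re := by
    rw [← Complex.conj_re, ← Complex.star_def, ← Matrix.star_dotProduct]
  have hqform : qform (nevanlinna F w) ((1 - F w) *ᵥ z) =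
      (star z ⬝ᵥ z).re - (star (F w *ᵥ z) ⬝ᵥ (F w *ᵥ z)).re := by
    rw [qform, hmul, Matrix.sub_mulVec, Matrix.one_mulVec, star_sub, sub_dotProduct,
      dotProduct_add, dotProduct_add]
    simp only [Complex.sub_re, Complex.add_re, hcross]
    ring
  rw [hqform]
  exact sub_nonneg.2 (re_star_mulVec_dotProduct_mulVec_le hF z)

theorem norm_toEuclideanCLM_le_one_of_mem_unitaryGroup {m : Type*} [Fintype m] [DecidableEq m]
    {U : Matrix m m ℂ} (hU : U ∈ Matrix.unitaryGroup m ℂ) :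
    ‖Matrix.toEuclideanCLM (𝕜 := ℂ) U‖ ≤ 1 := by
  have hU' : Matrix.toEuclideanCLM (𝕜 := ℂ) U ∈ unitary _ := Unitary.map_mem _ hU
  exact ContinuousLinearMap.opNorm_le_bound _ zero_le_one fun z => by
    rw [ContinuousLinearMap.norm_map_of_mem_unitary hU', one_mul]

theorem IsSchur.mul_unitary {X : Set ℂ} {B : ℂ → Matrix (Fin n) (Fin n) ℂ} (hB : IsSchur X B)
    {U : Matrix (Fin n) (Fin n) ℂ} (hU : U ∈ Matrix.unitaryGroup (Fin n) ℂ) :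
    IsSchur X fun w => B w * U where
  analytic := differentiableOn_matrix_mul hB.analytic fun i j => differentiableOn_const _
  contractive w hw := by
    rw [map_mul]
    exact (norm_mul_le _ _).trans (mul_le_one₀ (hB.contractive w hw) (norm_nonneg _)
      (norm_toEuclideanCLM_le_one_of_mem_unitaryGroup hU))

theorem nevanlinna_conj {F G : ℂ → Matrix (Fin n) (Fin n) ℂ} {R : Matrix (Fin n) (Fin n) ℂ}
    (hR : R ∈ Matrix.unitaryGroup (Fin n) ℂ) {w : ℂ} (hG : G w = Rᴴ * F w * R) :
    nevanlinna G w = Rᴴ * nevanlinna F w * R := by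
  have hRR : Rᴴ * R = 1 := Matrix.mem_unitaryGroup_iff'.1 hR
  have hRR' : R * Rᴴ = 1 := Matrix.mem_unitaryGroup_iff.1 hR
  have hsub : 1 - G w = Rᴴ * (1 - F w) * R := by
    rw [hG, Matrix.mul_sub, Matrix.sub_mul, Matrix.mul_one, hRR]
  have hadd : 1 + G w = Rᴴ * (1 + F w) * R := by
    rw [hG, Matrix.mul_add, Matrix.add_mul, Matrix.mul_one, hRR]
  rw [nevanlinna, nevanlinna, hsub, hadd, Matrix.mul_inv_rev, Matrix.mul_inv_rev,
    Matrix.inv_eq_left_inv hRR, Matrix.inv_eq_left_inv hRR']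
  simp only [Matrix.mul_assoc]
  rw [← Matrix.mul_assoc R Rᴴ, hRR', Matrix.one_mul]

variable {F G : ℂ → Matrix (Fin n) (Fin n) ℂ} {μ : MatrixMeasure n}

theorem exists_isClarkMeasure (hF : IsSchur upperHalf F)
    (hinv : ∀ w ∈ upperHalf, IsUnit (1 - F w)) : ∃ μ, IsClarkMeasure F μ := by
  simp only [isClarkMeasure_iff]
  exact exists_isNevanlinnaMeasure (differentiableOn_nevanlinna hF.analytic hinv)
    fun w hw => qform_nevanlinna_nonneg (hF.contractive w hw) (hinv w hw)

namespace IsClarkMeasure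

theorem unique {ν : MatrixMeasure n} (hμ : IsClarkMeasure F μ) (hν : IsClarkMeasure F ν) : μ = ν :=
  (isClarkMeasure_iff.1 hμ).unique (isClarkMeasure_iff.1 hν)

theorem conj {R : Matrix (Fin n) (Fin n) ℂ} (hμ : IsClarkMeasure F μ)
    (hR : R ∈ Matrix.unitaryGroup (Fin n) ℂ) (hG : ∀ w ∈ upperHalf, G w = Rᴴ * F w * R) :
    IsClarkMeasure G (μ.conj R) :=
  isClarkMeasure_iff.2 <| (isClarkMeasure_iff.1 hμ).conj fun w hw => nevanlinna_conj hR (hG w hw)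

theorem clarkMeasure_eq (hμ : IsClarkMeasure F μ) : clarkMeasure F = μ := by
  have h : ∃ μ, IsClarkMeasure F μ := ⟨μ, hμ⟩
  rw [clarkMeasure, dif_pos h]
  exact h.choose_spec.unique hμ

theorem existsUnique (hμ : IsClarkMeasure F μ) : ∃! μ, IsClarkMeasure F μ :=
  ⟨μ, hμ, fun _ h => h.unique hμ⟩

end IsClarkMeasure

theorem mainTheorem6_general {R : Matrix (Fin n) (Fin n) ℂ} (hF : IsSchur upperHalf F)
    (hinv : ∀ w ∈ upperHalf, IsUnit (1 - F w)) (hR : R ∈ Matrix.unitaryGroup (Fin n) ℂ)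
    (hG : ∀ w ∈ upperHalf, G w = Rᴴ * F w * R) :
    (∃! μ, IsClarkMeasure F μ) ∧ (∃! μ, IsClarkMeasure G μ) ∧
      ∀ Ω, clarkMeasure F Ω = R * clarkMeasure G Ω * Rᴴ := by
  obtain ⟨μ, hμ⟩ := exists_isClarkMeasure hF hinv
  have hν : IsClarkMeasure G (μ.conj R) := hμ.conj hR hG
  refine ⟨hμ.existsUnique, hν.existsUnique, fun Ω => ?_⟩
  have hRR : R * Rᴴ = 1 := Matrix.mem_unitaryGroup_iff.1 hR
  rw [hμ.clarkMeasure_eq, hν.clarkMeasure_eq]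
  calc μ Ω = (R * Rᴴ) * μ Ω * (R * Rᴴ) := by rw [hRR, Matrix.one_mul, Matrix.mul_one]
    _ = R * μ.conj R Ω * Rᴴ := by simp only [MatrixMeasure.conj, Matrix.mul_assoc]

end Schur

end

theorem mainTheorem6 (n : ℕ) (B₁ B₂ : ℂ → Matrix (Fin n) (Fin n) ℂ)
    (hB₁ : IsSchur upperHalf B₁) (hB₂ : IsSchur upperHalf B₂)
    (R Q α : Matrix (Fin n) (Fin n) ℂ)
    (hR : R ∈ Matrix.unitaryGroup (Fin n) ℂ) (hQ : Q ∈ Matrix.unitaryGroup (Fin n) ℂ)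
    (hα : α ∈ Matrix.unitaryGroup (Fin n) ℂ)
    (hequiv : ∀ w ∈ upperHalf, B₁ w = R * B₂ w * Q)
    (hinv : ∀ w ∈ upperHalf, IsUnit (1 - B₁ w * αᴴ)) :
    (∃! μ, IsClarkMeasure (fun w => B₁ w * αᴴ) μ) ∧
    (∃! μ, IsClarkMeasure (fun w => B₂ w * (Q * αᴴ * R)) μ) ∧
    ∀ s : ℝ, clarkMeasure (fun w => B₁ w * αᴴ) {s} =
      R * clarkMeasure (fun w => B₂ w * (Q * αᴴ * R)) {s} * Rᴴ := by
  have hRR : Rᴴ * R = 1 := Matrix.mem_unitaryGroup_iff'.1 hR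
  obtain ⟨h₁, h₂, h⟩ := mainTheorem6_general (hB₁.mul_unitary (Unitary.star_mem hα)) hinv hR
    fun w hw => show B₂ w * (Q * αᴴ * R) = Rᴴ * (B₁ w * αᴴ) * R by
      simp only [hequiv w hw, ← Matrix.mul_assoc, hRR, Matrix.one_mul]
  exact ⟨h₁, h₂, fun s => h {s}⟩
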